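/- Let $V$ be a finite-dimensional real vector space with origin $p=0$ and linear coordinates $x^1,\dots,x^n$. Let $\mathcal F$ be a singular foliation on $V$, i.e. a subsheaf of the sheaf $\mathfrak X$ of smooth vector fields on $V$ such that each $\mathcal F(U)$ is a $C^\infty(U)$-submodule of $\mathfrak X(U)$ closed under the Lie bracket, and such that every point of $V$ has an open neighbourhood $U$ with $\mathcal F(U)$ a finitely generated $C^\infty(U)$-module. Assume that $\{p\}$ is a leaf of $\mathcal F$. Let $$\cdots \xrightarrow{\partial_2} \Gamma(E_1) \xrightarrow{\partial_1} \Gamma(E_0) \xrightarrow{\rho} \mathcal F(V) \to 0$$ be an exact sequence of $C^\infty(V)$-modules, where $E_0,E_1,\dots$ are smooth real vector bundles of finite rank over $V$ (for instance with $E_i=0$ for all large $i$) and $\Gamma(E_i)$ denotes smooth global sections. Assume that it is minimal at $p$: for every $i\ge 1$ the vector bundle map $\partial_i:E_i\to E_{i-1}$ vanishes at $p$. Let $\Gamma(\wedge^k V^*)$ be the $C^\infty(V)$-module of smooth maps $V\to\wedge^kV^*$ (with $\wedge^{-1}V^*=0$), and let $d_k:\Gamma(\wedge^kV^*)\to\Gamma(\wedge^{k-1}V^*)$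 be the contraction $\iota_{x^j\partial_{x^j}}$ with the Euler vector field. Then for every $i\ge 0$ (in particular for $i=0,\dots,n$) $$(E_i)_p \;\cong\; H^i\big(\Gamma(\wedge^\bullet V^*)\otimes_{C^\infty(V)}\mathcal F(V),\ d_\bullet\otimes\mathrm{id}\big)\;=\;\frac{\ker (d_i\otimes \mathrm{id})}{\operatorname{im}(d_{i+1}\otimes\mathrm{id})},$$ and also $$(E_i)_p\;\cong\;\operatorname{Tor}_i^{C^\infty(V)}(\mathcal F(V),\mathbb R),$$ where $C^\infty(V)$ acts on $\mathbb R$ and on $(E_i)_p$ through evaluation at $p$, and the isomorphisms are isomorphisms of $C^\infty(V)$-modules (in particular of real vector spaces). -/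

import Mathlib

open Set TopologicalSpace Bundle CategoryTheory
open scoped Manifold ContDiff TensorProduct

noncomputable section

namespace SingFol

universe u

/-! ### Smooth functions and smooth sections on a vector space -/

section Functions

variable (V : Type u) [NormedAddCommGroup V] [NormedSpace ℝ V]

/-- The ring `C^∞(V)`. -/
abbrev SmoothFun : Type u := C^∞⟮𝓘(ℝ, V), V; 𝓘(ℝ, ℝ), ℝ⟯

/-- `Γ(W)`: the `C^∞(V)`-module of global sections of the trivial bundle `W × V → V`, that is, of
smooth maps `V → W`. -/
abbrev TrivSec (W : Type u) [NormedAddCommGroup W] [NormedSpace ℝ W] : Type u :=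
  C^∞⟮𝓘(ℝ, V), V; 𝓘(ℝ, W), W⟯

/-- The `C^∞(V)`-module of vector fields on `V`, the tangent bundle being `V × V`. -/
abbrev VecField : Type u := TrivSec V V

variable {V}

/-- Evaluation of smooth functions at `p`. -/
def evalAt (p : V) : SmoothFun V →+* ℝ where
  toFun f := f p
  map_one' := rfl
  map_mul' _ _ := rfl
  map_zero' := rfl
  map_add' _ _ := rfl

/-- A real vector space `W`, regarded as a `C^∞(V)`-module on which `f` acts as
multiplication by the number `f p`. -/
def AtPoint (_p : V) (W : Type*) : Type _ := W

instance (p : V) (W : Type*) [AddCommGroup W] : AddCommGroup (AtPoint p W) :=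
  inferInstanceAs (AddCommGroup W)

instance (p : V) (W : Type*) [AddCommGroup W] [Module ℝ W] :
    Module (SmoothFun V) (AtPoint p W) :=
  Module.compHom W (evalAt p)

end Functions

section Sections

variable {V : Type u} [NormedAddCommGroup V] [NormedSpace ℝ V]
  {Fib : Type*} [NormedAddCommGroup Fib] [NormedSpace ℝ Fib]
  {E : V → Type*} [TopologicalSpace (TotalSpace Fib E)]
  [∀ x, TopologicalSpace (E x)] [∀ x, AddCommGroup (E x)] [∀ x, Module ℝ (E x)]
  [FiberBundle Fib E] [VectorBundle ℝ Fib E]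

/-- Smooth sections of a vector bundle over `V` form a `C^∞(V)`-module, pointwise. -/
instance sectionModule : Module (SmoothFun V) Cₛ^∞⟮𝓘(ℝ, V); Fib, E⟯ where
  smul f s := ⟨fun x => f x • s x, f.contMDiff.smul_section s.contMDiff⟩
  one_smul s := by ext x; exact one_smul ℝ (s x)
  mul_smul f g s := by ext x; exact mul_smul (f x) (g x) (s x)
  smul_zero f := by ext x; exact smul_zero (f x)
  zero_smul s := by ext x; exact zero_smul ℝ (s x)
  smul_add f s t := by ext x; exact smul_add (f x) (s x) (t x)
  add_smul f g s := by ext x; exact add_smul (f x) (g x) (s x)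

end Sections

/-! ### Singular foliations -/

section Foliations

variable (V : Type u) [NormedAddCommGroup V] [NormedSpace ℝ V]

/-- The ring `C^∞(U)` for `U ⊆ V` open. -/
abbrev SmoothFunOn (U : Opens V) : Type u := C^∞⟮𝓘(ℝ, V), U; 𝓘(ℝ, ℝ), ℝ⟯

/-- The `C^∞(U)`-module `𝔛(U)` of vector fields on an open subset `U ⊆ V`. -/
abbrev VecFieldOn (U : Opens V) : Type u := C^∞⟮𝓘(ℝ, V), U; 𝓘(ℝ, V), V⟯

variable {V}

/-- Restriction of vector fields to a smaller open set. -/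
def VecFieldOn.restrict {U W : Opens V} (h : W ≤ U) (X : VecFieldOn V U) : VecFieldOn V W :=
  ⟨fun x => X ⟨x.1, h x.2⟩, X.contMDiff.comp (contMDiff_inclusion h)⟩

/-- A vector field on `V`, seen as a vector field on the open subset `⊤` of `V`. -/
def VecField.toTop (X : VecField V) : VecFieldOn V ⊤ :=
  ⟨fun x => X x.1, X.contMDiff.comp contMDiff_subtype_val⟩

variable (V)

/-- A singular foliation on `V`: a subsheaf of the sheaf of vector fields on `V` consisting of
`C^∞`-submodules (`restrict_mem` and `glue_mem` say that it is a subsheaf), closed under the Lie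
bracket and locally finitely generated. -/
structure SingularFoliation where
  sections : ∀ U : Opens V, Submodule (SmoothFunOn V U) (VecFieldOn V U)
  restrict_mem : ∀ {U W : Opens V} (h : W ≤ U) (X : VecFieldOn V U),
    X ∈ sections U → X.restrict h ∈ sections W
  glue_mem : ∀ (U : Opens V) (X : VecFieldOn V U),
    (∀ x ∈ U, ∃ (W : Opens V) (h : W ≤ U), x ∈ W ∧ X.restrict h ∈ sections W) →
    X ∈ sections U
  lie_mem : ∀ (U : Opens V), ∀ X ∈ sections U, ∀ Y ∈ sections U, ∃ Z ∈ sections U,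
    ∀ x : U, Z x = VectorField.mlieBracket 𝓘(ℝ, V) (M := U) (fun y => X y) (fun y => Y y) x
  locally_fg : ∀ x : V, ∃ U : Opens V, x ∈ U ∧ (sections U).FG

namespace SingularFoliation

variable {V}
variable (F : SingularFoliation V)

/-- The `C^∞(V)`-module `F(V)` of global sections of the foliation. -/
def globalSections : Submodule (SmoothFun V) (VecField V) where
  carrier := {X | VecField.toTop X ∈ F.sections ⊤}
  add_mem' {_ _} hX hY := (F.sections ⊤).add_mem hX hY
  zero_mem' := (F.sections ⊤).zero_mem
  smul_mem' f _ hX := (F.sections ⊤).smul_mem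
    (⟨fun x => f x.1, f.contMDiff.comp contMDiff_subtype_val⟩ : SmoothFunOn V ⊤) hX

/-- `y` is reached from `x` by following an integral curve of a vector field of the foliation
for time `1`. -/
def FlowsTo (x y : V) : Prop :=
  ∃ X ∈ F.globalSections, ∃ γ : ℝ → V, γ 0 = x ∧ γ 1 = y ∧
    ∀ t ∈ Icc (0 : ℝ) 1, HasDerivWithinAt γ (X (γ t)) (Icc 0 1) t

/-- The leaf through `x`: all points that are reached from `x` by following finitely many
integral curves of vector fields of the foliation. -/
def leaf (x : V) : Set V := {y | Relation.ReflTransGen F.FlowsTo x y}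

/-- `L` is a leaf of the foliation. -/
def IsLeaf (L : Set V) : Prop := ∃ x, L = F.leaf x

end SingularFoliation

end Foliations

/-! ### Resolutions by vector bundles -/

section Resolutions

variable {V : Type u} [NormedAddCommGroup V] [NormedSpace ℝ V]

/-- A resolution `⋯ → Γ(E 2) → Γ(E 1) → Γ(E 0) → F(V) → 0` of the foliation by the
`C^∞(V)`-modules of smooth sections of vector bundles over `V`. (Maps of `C^∞(V)`-modules
between section spaces are the same as smooth vector bundle maps. A resolution of finite length
is one with `E i = 0` for large `i`.) -/
structure Resolution (F : SingularFoliation V)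
    {Fib : ℕ → Type*} [∀ i, NormedAddCommGroup (Fib i)] [∀ i, NormedSpace ℝ (Fib i)]
    (E : ℕ → V → Type*) [∀ i, TopologicalSpace (TotalSpace (Fib i) (E i))]
    [∀ i x, TopologicalSpace (E i x)] [∀ i x, AddCommGroup (E i x)]
    [∀ i x, Module ℝ (E i x)] [∀ i, FiberBundle (Fib i) (E i)]
    [∀ i, VectorBundle ℝ (Fib i) (E i)] where
  /-- The differential `∂_{i+1} : Γ(E (i+1)) → Γ(E i)`. -/
  d : ∀ i, Cₛ^∞⟮𝓘(ℝ, V); Fib (i + 1), E (i + 1)⟯ →ₗ[SmoothFun V] Cₛ^∞⟮𝓘(ℝ, V); Fib i, E i⟯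
  /-- The anchor, as a map `Γ(E 0) → F(V)`. -/
  ρ : Cₛ^∞⟮𝓘(ℝ, V); Fib 0, E 0⟯ →ₗ[SmoothFun V] F.globalSections
  exact_d : ∀ i, Function.Exact (d (i + 1)) (d i)
  exact_ρ : Function.Exact (d 0) ρ
  surjective_ρ : Function.Surjective ρ

/-- The resolution is minimal at `p`: all its differentials `∂_i : E i → E (i-1)`, `i ≥ 1`, vanish
at `p` as vector bundle maps, i.e. the section `∂ s` vanishes at `p` for every section `s`. -/
def Resolution.IsMinimalAt {F : SingularFoliation V}
    {Fib : ℕ → Type*} [∀ i, NormedAddCommGroup (Fib i)] [∀ i, NormedSpace ℝ (Fib i)]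
    {E : ℕ → V → Type*} [∀ i, TopologicalSpace (TotalSpace (Fib i) (E i))]
    [∀ i x, TopologicalSpace (E i x)] [∀ i x, AddCommGroup (E i x)]
    [∀ i x, Module ℝ (E i x)] [∀ i, FiberBundle (Fib i) (E i)]
    [∀ i, VectorBundle ℝ (Fib i) (E i)] (R : Resolution F (Fib := Fib) E) (p : V) : Prop :=
  ∀ i, ∀ s, R.d i s p = 0

end Resolutions

/-! ### The Koszul complex of the Euler vector field -/

section Koszul

variable (V : Type u) [NormedAddCommGroup V] [NormedSpace ℝ V]

/-- `Γ(∧^k V*)`: differential `k`-forms on `V`. -/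
abbrev Forms (k : ℕ) : Type u := TrivSec V (V [⋀^Fin k]→L[ℝ] ℝ)

/-- `d_{k+1} = ι_{x^i ∂_{x^i}} : Γ(∧^{k+1} V*) → Γ(∧^k V*)`, the contraction with the Euler vector
field, whose value at `x ∈ V` is the vector `x`. -/
def contractEuler (k : ℕ) : Forms V (k + 1) →ₗ[SmoothFun V] Forms V k where
  toFun α := ⟨fun x => (α x).curryLeft x, by
    have h : ContDiff ℝ ∞ (fun x : V => α x) := α.contMDiff.contDiff
    exact ((((ContinuousAlternatingMap.curryLeftLI (𝕜 := ℝ) (E := V) (F := ℝ)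
      (n := k)).contDiff.comp h)).clm_apply contDiff_id).contMDiff⟩
  map_add' _ _ := rfl
  map_smul' _ _ := rfl

theorem contractEuler_comp (k : ℕ) :
    (contractEuler V k).comp (contractEuler V (k + 1)) = 0 := by
  ext α x v
  exact congrArg (fun β => β v) (ContinuousAlternatingMap.curryLeft_same (α x) x)

/-- The complex `(Γ(∧^• V*) ⊗_{C^∞(V)} M, ι_{x^i ∂_{x^i}} ⊗ id)` of `C^∞(V)`-modules. -/
def koszul (M : Type u) [AddCommGroup M] [Module (SmoothFun V) M] :
    ChainComplex (ModuleCat.{u} (SmoothFun V)) ℕ :=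
  ChainComplex.of (fun k => ModuleCat.of (SmoothFun V) (Forms V k ⊗[SmoothFun V] M))
    (fun k => ModuleCat.ofHom ((contractEuler V k).rTensor M))
    (fun k => by
      rw [← ModuleCat.ofHom_comp, ← LinearMap.rTensor_comp, contractEuler_comp]
      simp)

/-- `Tor_i^{C^∞(V)}(M, ℝ)`, with `C^∞(V)` acting on `ℝ` by evaluation at `p`. -/
def torAt (p : V) (i : ℕ) (M : Type u) [AddCommGroup M] [Module (SmoothFun V) M] :
    ModuleCat.{u} (SmoothFun V) :=
  ((Tor (ModuleCat.{u} (SmoothFun V)) i).obj (ModuleCat.of _ M)).obj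
    (ModuleCat.of _ (ULift.{u} (AtPoint p ℝ)))

end Koszul

end SingFol

end

noncomputable section

namespace SingFol

universe u

/-! ### Smooth dependence of integrals on parameters -/

section ParametricIntegral

variable {V : Type u} [NormedAddCommGroup V] [NormedSpace ℝ V] [FiniteDimensional ℝ V]

/-! Write `A` for the ring of smooth functions on `V` and `K` for the Koszul complex of the Euler
vector field. `K` is a free resolution of `ℝ = A/m`, where `m` is the ideal of functions vanishing
at 0. Exactness in positive degrees comes from the homotopy formula of the Poincaré lemma
(`exists_contractEuler_eq`), and in degree 0 from Hadamard's lemma (`exists_contractEuler_zero_eq`).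
Hence the homology of `M ⊗ K` is `Tor(M, ℝ)`, and with `M = F(V)` the two isomorphisms reduce to a
single one.

It remains to compute this homology from the minimal resolution, by dimension shifting
(`nonempty_homology_iso_of_minimal`). Two properties of `P = Γ(E_i)` are needed. (a) `P ⊗ K` is
acyclic in positive degrees. Global projectivity of `P` is not used: a function `c` with `c(0) = 1`
acts on `P` through a finite free module (`exists_cutoff_frame`), and it acts on `K` homotopically
to the identity because it acts as 1 on `ℝ`. So the identity of the homology factors through zero
(`isZero_homology_tensorComplex`). (b) The zeroth homology of `P ⊗ K` is `P/mP`, the fibre at 0.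
Minimality then says exactly that the differentials induce zero on zeroth homology. -/

theorem hasFDerivAt_integral_of_contDiff {W : Type u} [NormedAddCommGroup W] [NormedSpace ℝ W]
    {f : V × ℝ → W} (hf : ContDiff ℝ ∞ f) (x : V) :
    HasFDerivAt (fun y => ∫ t in (0 : ℝ)..1, f (y, t))
      (∫ t in (0 : ℝ)..1, (fderiv ℝ f (x, t)).comp (ContinuousLinearMap.inl ℝ V ℝ)) x := by
  have hproper : ProperSpace V := FiniteDimensional.proper ℝ V
  have hfc : Continuous f := hf.continuous
  have hgc : Continuous (fun z : V × ℝ =>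
      (fderiv ℝ f z).comp (ContinuousLinearMap.inl ℝ V ℝ)) :=
    (hf.continuous_fderiv (by simp)).clm_comp continuous_const
  -- In finite dimension closed balls are compact, so the partial derivative is bounded on ball ×
  -- [0,1]; this constant is the dominating function.
  obtain ⟨C, hC⟩ := ((isCompact_closedBall x 1).prod (isCompact_Icc (a := (0 : ℝ)) (b := 1))
    ).exists_bound_of_continuousOn hgc.continuousOn
  refine intervalIntegral.hasFDerivAt_integral_of_dominated_of_fderiv_le
    (F := fun y t => f (y, t))
    (F' := fun y t => (fderiv ℝ f (y, t)).comp (ContinuousLinearMap.inl ℝ V ℝ))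
    (bound := fun _ => C) (s := Metric.closedBall x 1)
    (Metric.closedBall_mem_nhds x one_pos) ?_ ?_ ?_ ?_ ?_ ?_
  · exact .of_forall fun y => (hfc.comp (by fun_prop : Continuous fun t : ℝ => (y, t))
      ).aestronglyMeasurable
  · exact (hfc.comp (by fun_prop : Continuous fun t : ℝ => (x, t))).intervalIntegrable _ _
  · exact (hgc.comp (by fun_prop : Continuous fun t : ℝ => (x, t))).aestronglyMeasurable
  · refine .of_forall fun t ht y hy => hC (y, t) ⟨hy, ?_⟩
    rw [uIoc_of_le zero_le_one] at ht
    exact ⟨ht.1.le, ht.2⟩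
  · exact intervalIntegrable_const
  · refine .of_forall fun t _ y _ => ?_
    have h1 : HasFDerivAt f (fderiv ℝ f (y, t)) (y, t) :=
      (hf.differentiable (by simp) _).hasFDerivAt
    exact h1.comp y (hasFDerivAt_prodMk_left y t)

/-- The derivative is again a parametric integral, with values in `V →L[ℝ] W`; this is why the
induction varies `W`. -/
theorem contDiff_integral_nat (n : ℕ) {W : Type u} [NormedAddCommGroup W] [NormedSpace ℝ W]
    {f : V × ℝ → W} (hf : ContDiff ℝ ∞ f) :
    ContDiff ℝ n (fun y => ∫ t in (0 : ℝ)..1, f (y, t)) := by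
  induction n generalizing W with
  | zero =>
    exact contDiff_zero.2 <| continuous_iff_continuousAt.2 fun x =>
      (hasFDerivAt_integral_of_contDiff hf x).continuousAt
  | succ n ih =>
    rw [Nat.cast_succ]
    refine contDiff_succ_iff_hasFDerivAt.2 ⟨_, ?_, hasFDerivAt_integral_of_contDiff hf⟩
    exact ih (f := fun z => (fderiv ℝ f z).comp (ContinuousLinearMap.inl ℝ V ℝ))
      ((hf.fderiv_right (by simp)).clm_comp contDiff_const)

theorem contDiff_integral {W : Type u} [NormedAddCommGroup W] [NormedSpace ℝ W]
    {f : V × ℝ → W} (hf : ContDiff ℝ ∞ f) :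
    ContDiff ℝ ∞ (fun y => ∫ t in (0 : ℝ)..1, f (y, t)) :=
  contDiff_infty.2 fun n => contDiff_integral_nat n hf

end ParametricIntegral

/-! ### Exactness of the Koszul complex of the Euler vector field -/

section Exactness

variable {V : Type u} [NormedAddCommGroup V] [NormedSpace ℝ V]

/-- The homotopy formula for the Euler vector field on forms `α` with `ι_E α = 0`. -/
theorem smul_extDeriv_euler {k : ℕ} {α : V → V [⋀^Fin (k + 1)]→L[ℝ] ℝ}
    (hα : Differentiable ℝ α) (h0 : ∀ x, (α x).curryLeft x = 0) (x : V) (t : ℝ)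
    (v : Fin (k + 1) → V) :
    t * extDeriv α (t • x) (Matrix.vecCons x v) =
      t * fderiv ℝ α (t • x) x v + (k + 1) * α (t • x) v := by
  -- The derivative of the identity `α y (y, w) = 0` in `y`, in the direction `u`.
  have key : ∀ (y u : V) (w : Fin k → V),
      fderiv ℝ α y u (Matrix.vecCons y w) + α y (Matrix.vecCons u w) = 0 := by
    intro y u w
    have hl : HasDerivAt (fun s : ℝ => α (y + s • u)) (fderiv ℝ α y u) 0 := by
      have e : HasDerivAt (fun s : ℝ => y + s • u) u 0 := by
        simpa using ((hasDerivAt_id (0 : ℝ)).smul_const u).const_add y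
      have e' : HasFDerivAt α (fderiv ℝ α y) (y + (0 : ℝ) • u) := by
        simpa using (hα y).hasFDerivAt
      exact e'.comp_hasDerivAt 0 e
    have hv : ∀ v, HasDerivAt (fun s : ℝ => α (y + s • u) v) (fderiv ℝ α y u v) 0 := fun v =>
      (ContinuousAlternatingMap.apply ℝ V ℝ v).hasFDerivAt.comp_hasDerivAt 0 hl
    have h1 := (hv (Matrix.vecCons y w)).fun_add
      ((hasDerivAt_id' (0 : ℝ)).fun_mul (hv (Matrix.vecCons u w)))
    have h2 : (fun s : ℝ => α (y + s • u) (Matrix.vecCons y w) +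
        s * α (y + s • u) (Matrix.vecCons u w)) = fun _ => 0 := by
      funext s
      have e1 := (α (y + s • u)).toAlternatingMap.map_vecCons_add w y (s • u)
      have e2 := (α (y + s • u)).toAlternatingMap.map_vecCons_smul w s u
      have e3 := congrArg (fun β => β w) (h0 (y + s • u))
      simp only [ContinuousAlternatingMap.coe_toAlternatingMap, smul_eq_mul] at e1 e2
      rw [← e2, ← e1]
      exact e3
    rw [h2] at h1
    simpa using (h1.unique (hasDerivAt_const _ _))
  rw [extDeriv, ContinuousAlternatingMap.alternatizeUncurryFin_apply, Fin.sum_univ_succ, mul_add]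
  congr 1
  · simp [Matrix.vecCons]
  -- `key` at `t • x` trades the derivative along `v i` for `-α`. Moving `v i` back to its slot
  -- costs `(-1) ^ i`, so all signs cancel and each of the `k + 1` terms equals `α (t • x) v`.
  · have : ∀ i : Fin (k + 1), t * ((-1) ^ (i.succ : ℕ) •
        fderiv ℝ α (t • x) (Matrix.vecCons x v i.succ) (i.succ.removeNth (Matrix.vecCons x v))) =
        α (t • x) v := by
      intro i
      have e1 : i.succ.removeNth (Matrix.vecCons x v) = Matrix.vecCons x (i.removeNth v) := by
        ext j
        refine Fin.cases ?_ (fun j => ?_) j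
        · simp [Fin.removeNth_apply]
        · simp [Fin.removeNth_apply]
      have e2 := key (t • x) (v i) (i.removeNth v)
      have e3 : (fderiv ℝ α (t • x) (v i)) (Matrix.vecCons (t • x) (i.removeNth v)) =
          t * (fderiv ℝ α (t • x) (v i)) (Matrix.vecCons x (i.removeNth v)) := by
        simpa using ((fderiv ℝ α (t • x) (v i)).toAlternatingMap.map_vecCons_smul
          (i.removeNth v) t x)
      have e4 := (α (t • x)).toAlternatingMap.map_insertNth i (v i) (i.removeNth v)
      rw [Fin.insertNth_self_removeNth] at e4
      simp only [ContinuousAlternatingMap.coe_toAlternatingMap] at e4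
      rw [e1, Matrix.cons_val_succ, e4]
      rw [e3] at e2
      simp only [Fin.val_succ, pow_succ, zsmul_eq_mul]
      push_cast
      linear_combination (-(-1 : ℝ) ^ (i : ℕ)) * e2
    rw [Finset.mul_sum, Finset.sum_congr rfl fun i _ => this i]
    simp

variable [FiniteDimensional ℝ V]

/-- The primitive is `β x = ∫ t ^ (k + 1) • dα (t • x)` over [0,1]. By the homotopy formula its
contraction with `x` is the integral of the `t`-derivative of `t ^ (k + 1) • α (t • x)`, and the
positive exponent kills the endpoint `t = 0`. -/
theorem exists_contractEuler_eq {k : ℕ} (α : Forms V (k + 1)) (h : contractEuler V k α = 0) :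
    ∃ β : Forms V (k + 2), contractEuler V (k + 1) β = α := by
  have hα : ContDiff ℝ ∞ (fun x : V => α x) := α.contMDiff.contDiff
  have h0 : ∀ x, (α x).curryLeft x = 0 := fun x => DFunLike.congr_fun h x
  have hd : ContDiff ℝ ∞ (fun x : V => extDeriv α x) :=
    (ContinuousAlternatingMap.alternatizeUncurryFinCLM ℝ V ℝ).contDiff.comp
      (hα.fderiv_right (by simp))
  have hg : ContDiff ℝ ∞ (fun z : V × ℝ => z.2 ^ (k + 1) • extDeriv α (z.2 • z.1)) :=
    (contDiff_snd.pow _).smul (hd.comp (contDiff_snd.smul contDiff_fst))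
  refine ⟨⟨_, (contDiff_integral hg).contMDiff⟩, ?_⟩
  ext x v
  change (∫ t in (0 : ℝ)..1, t ^ (k + 1) • extDeriv α (t • x)) (Matrix.vecCons x v) = α x v
  have hc : Continuous (fun t : ℝ => t ^ (k + 1) • extDeriv α (t • x)) :=
    hg.continuous.comp (by fun_prop : Continuous fun t : ℝ => (x, t))
  have e := (ContinuousAlternatingMap.apply ℝ V ℝ (Matrix.vecCons x v)
    ).intervalIntegral_comp_comm (hc.intervalIntegrable (μ := MeasureTheory.volume) 0 1)
  have hder : ∀ t : ℝ, HasDerivAt (fun t : ℝ => t ^ (k + 1) * α (t • x) v)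
      (t ^ (k + 1) * extDeriv α (t • x) (Matrix.vecCons x v)) t := by
    intro t
    have h1 : HasDerivAt (fun t : ℝ => t • x) x t := by
      simpa using (hasDerivAt_id t).smul_const x
    have h2 : HasDerivAt (fun t : ℝ => α (t • x)) (fderiv ℝ α (t • x) x) t :=
      ((hα.differentiable (by simp)) (t • x)).hasFDerivAt.comp_hasDerivAt t h1
    have h3 : HasDerivAt (fun t : ℝ => α (t • x) v) (fderiv ℝ α (t • x) x v) t :=
      (ContinuousAlternatingMap.apply ℝ V ℝ v).hasFDerivAt.comp_hasDerivAt t h2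
    have h4 := (hasDerivAt_pow (k + 1) t).mul h3
    refine h4.congr_deriv ?_
    have h5 := smul_extDeriv_euler (hα.differentiable (by simp)) h0 x t v
    rw [Nat.add_sub_cancel]
    push_cast
    linear_combination -t ^ k * h5
  have hint := intervalIntegral.integral_eq_sub_of_hasDerivAt (fun t _ => hder t)
    (((ContinuousAlternatingMap.apply ℝ V ℝ (Matrix.vecCons x v)).continuous.comp hc
      ).intervalIntegrable 0 1)
  have e' := e.symm.trans hint
  simpa using e'

/-- Hadamard's lemma. -/
theorem exists_contractEuler_zero_eq (α : Forms V 0) (h : α 0 = 0) :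
    ∃ β : Forms V 1, contractEuler V 0 β = α := by
  have hα : ContDiff ℝ ∞ (fun x : V => α x) := α.contMDiff.contDiff
  have hd : ContDiff ℝ ∞ (fun x : V => extDeriv α x) :=
    (ContinuousAlternatingMap.alternatizeUncurryFinCLM ℝ V ℝ).contDiff.comp
      (hα.fderiv_right (by simp))
  -- In degree 0 there is no weight in `t`; the endpoint `t = 0` contributes `α 0`, which vanishes
  -- by `h`.
  have hg : ContDiff ℝ ∞ (fun z : V × ℝ => extDeriv α (z.2 • z.1)) :=
    hd.comp (contDiff_snd.smul contDiff_fst)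
  refine ⟨⟨_, (contDiff_integral hg).contMDiff⟩, ?_⟩
  ext x v
  change (∫ t in (0 : ℝ)..1, extDeriv α (t • x)) (Matrix.vecCons x v) = α x v
  have hc : Continuous (fun t : ℝ => extDeriv α (t • x)) :=
    hg.continuous.comp (by fun_prop : Continuous fun t : ℝ => (x, t))
  have e := (ContinuousAlternatingMap.apply ℝ V ℝ (Matrix.vecCons x v)
    ).intervalIntegral_comp_comm (hc.intervalIntegrable (μ := MeasureTheory.volume) 0 1)
  have hder : ∀ t : ℝ, HasDerivAt (fun t : ℝ => α (t • x) v)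
      (extDeriv α (t • x) (Matrix.vecCons x v)) t := by
    intro t
    have h1 : HasDerivAt (fun t : ℝ => t • x) x t := by
      simpa using (hasDerivAt_id t).smul_const x
    have h2 : HasDerivAt (fun t : ℝ => α (t • x)) (fderiv ℝ α (t • x) x) t :=
      ((hα.differentiable (by simp)) (t • x)).hasFDerivAt.comp_hasDerivAt t h1
    have h3 : HasDerivAt (fun t : ℝ => α (t • x) v) (fderiv ℝ α (t • x) x v) t :=
      (ContinuousAlternatingMap.apply ℝ V ℝ v).hasFDerivAt.comp_hasDerivAt t h2
    convert h3 using 1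
    rw [extDeriv, ContinuousAlternatingMap.alternatizeUncurryFin_apply]
    simp [Subsingleton.elim _ v]
  have hint := intervalIntegral.integral_eq_sub_of_hasDerivAt (fun t _ => hder t)
    (((ContinuousAlternatingMap.apply ℝ V ℝ (Matrix.vecCons x v)).continuous.comp hc
      ).intervalIntegrable 0 1)
  have e' := e.symm.trans hint
  simpa [h] using e'

end Exactness

/-! ### Homology of tensor products with a projective resolution -/

section TensorComplex

open MonoidalCategory Limits HomologicalComplex

variable {A : Type u} [CommRing A]

/-- The functor `M ↦ M ⊗ K` for a chain complex `K` of modules. -/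
def tensorComplex (K : ChainComplex (ModuleCat.{u} A) ℕ) :
    ModuleCat.{u} A ⥤ ChainComplex (ModuleCat.{u} A) ℕ where
  obj M := (((tensoringLeft (ModuleCat.{u} A)).obj M).mapHomologicalComplex _).obj K
  map f := (NatTrans.mapHomologicalComplex ((tensoringLeft (ModuleCat.{u} A)).map f) _).app K
  map_id M := by simp
  map_comp f g := by simp

instance (K : ChainComplex (ModuleCat.{u} A) ℕ) : (tensorComplex K).PreservesZeroMorphisms where
  map_zero M N := by
    ext k : 1
    exact MonoidalPreadditive.zero_whiskerRight (C := ModuleCat.{u} A)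

theorem tensorComplex_shortExact (K : ChainComplex (ModuleCat.{u} A) ℕ)
    [∀ k, Module.Flat A (K.X k)] (S : ShortComplex (ModuleCat.{u} A)) (hS : S.ShortExact) :
    (S.map (tensorComplex K)).ShortExact := by
  refine HomologicalComplex.shortExact_of_degreewise_shortExact _ fun k => ?_
  exact hS.map_of_exact (tensorRight (K.X k))

/-- Zeroth homology embeds in the cokernel of the last differential, where boundaries vanish. -/
theorem homologyMap_zero_eq_zero {C D : ChainComplex (ModuleCat.{u} A) ℕ} (φ : C ⟶ D)
    (h : ∀ x, ∃ y, D.d 1 0 y = φ.f 0 x) : homologyMap φ 0 = 0 := by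
  have h1 : φ.f 0 ≫ D.pOpcycles 0 = 0 := by
    ext x
    obtain ⟨y, hy⟩ := h x
    have e := congr($(D.d_pOpcycles 1 0) y)
    simp only [ModuleCat.hom_comp, LinearMap.comp_apply, ModuleCat.hom_zero,
      LinearMap.zero_apply] at e ⊢
    rw [← hy]
    exact e
  have h2 : opcyclesMap φ 0 = 0 := by
    rw [← cancel_epi (C.pOpcycles 0), p_opcyclesMap, h1, comp_zero]
  rw [← cancel_mono (D.homologyι 0), homologyι_naturality, h2, zero_comp, comp_zero]

theorem epi_homologyMap_zero {C D : ChainComplex (ModuleCat.{u} A) ℕ} (φ : C ⟶ D)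
    (h : Epi (φ.f 0)) : Epi (homologyMap φ 0) := by
  have h1 : Epi (opcyclesMap φ 0) := by
    have : Epi (C.pOpcycles 0 ≫ opcyclesMap φ 0) := by
      rw [p_opcyclesMap]; infer_instance
    exact epi_of_epi (C.pOpcycles 0) _
  have : Epi (homologyMap φ 0 ≫ D.homologyι 0) := by
    rw [homologyι_naturality]; infer_instance
  exact (epi_comp_iff_of_isIso _ (D.homologyι 0)).1 this

/-- The zeroth homology of a chain complex is the cokernel of its last differential. -/
theorem exists_homology_zero_equiv (C : ChainComplex (ModuleCat.{u} A) ℕ) {Q : Type*}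
    [AddCommGroup Q] [Module A Q] (ε : C.X 0 →ₗ[A] Q) (hε : Function.Surjective ε)
    (hex : Function.Exact (C.d 1 0).hom ε) :
    Nonempty (C.homology 0 ≃ₗ[A] Q) := by
  let q : C.X 0 ⟶ ModuleCat.of A (C.X 0 ⧸ LinearMap.range (C.d 1 0).hom) :=
    ModuleCat.ofHom (Submodule.mkQ _)
  have hdq : C.d 1 0 ≫ q = 0 := by
    ext x
    exact (Submodule.Quotient.mk_eq_zero _).2 ⟨x, rfl⟩
  have hepi : Epi q := (ModuleCat.epi_iff_surjective _).2 (Submodule.mkQ_surjective _)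
  have hS : (ShortComplex.mk _ _ hdq).Exact := by
    rw [ShortComplex.moduleCat_exact_iff]
    intro x hx
    exact (Submodule.Quotient.mk_eq_zero _).1 hx
  have i1 : C.homology 0 ≅ ModuleCat.of A (C.X 0 ⧸ LinearMap.range (C.d 1 0).hom) :=
    C.isoHomologyι₀ ≪≫ (C.opcyclesIsCokernel 1 0 (by simp)).coconePointUniqueUpToIso hS.gIsCokernel
  exact ⟨i1.toLinearEquiv ≪≫ₗ Submodule.quotEquivOfEq _ _ hex.linearMap_ker_eq.symm ≪≫ₗ
    ε.quotKerEquivOfSurjective hε⟩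

/-- If the homology of the middle term of a short exact sequence does not contribute, the
connecting map is an isomorphism. -/
theorem nonempty_homology_succ_iso {S : ShortComplex (ChainComplex (ModuleCat.{u} A) ℕ)}
    (hS : S.ShortExact) (k : ℕ) (h1 : IsZero (S.X₂.homology (k + 1)))
    (h0 : homologyMap S.f k = 0) :
    Nonempty (S.X₃.homology (k + 1) ≅ S.X₁.homology k) := by
  have hrel : (ComplexShape.down ℕ).Rel (k + 1) k := by simp
  have hm : Mono (hS.δ (k + 1) k hrel) := hS.mono_δ _ _ hrel h1
  have he : Epi (hS.δ (k + 1) k hrel) := (hS.homology_exact₁ (k + 1) k hrel).epi_f h0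
  have := isIso_of_mono_of_epi (hS.δ (k + 1) k hrel)
  exact ⟨asIso (hS.δ (k + 1) k hrel)⟩

/-- The long exact sequence makes the map induced by `S.g` injective; surjectivity is right
exactness of zeroth homology. -/
theorem nonempty_homology_zero_iso {S : ShortComplex (ChainComplex (ModuleCat.{u} A) ℕ)}
    (hS : S.ShortExact) (h0 : homologyMap S.f 0 = 0) :
    Nonempty (S.X₂.homology 0 ≅ S.X₃.homology 0) := by
  have hm : Mono (homologyMap S.g 0) := (hS.homology_exact₂ 0).mono_g h0
  have hepi : Epi S.g := hS.epi_g
  have he : Epi (homologyMap S.g 0) :=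
    epi_homologyMap_zero S.g (inferInstanceAs (Epi ((HomologicalComplex.eval _ _ 0).map S.g)))
  have := isIso_of_mono_of_epi (homologyMap S.g 0)
  exact ⟨asIso (homologyMap S.g 0)⟩

theorem isZero_homology_tensorComplex_of_flat {X : ModuleCat.{u} A} (K : ProjectiveResolution X)
    (L : ModuleCat.{u} A) [Module.Flat A L] (k : ℕ) :
    IsZero (((tensorComplex K.complex).obj L).homology (k + 1)) := by
  refine (exactAt_iff_isZero_homology _ _).1 ?_
  have h := K.complex_exactAt_succ k
  rw [exactAt_iff' _ (k + 2) (k + 1) k (by simp) (by simp)] at h ⊢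
  exact Module.Flat.lTensor_shortComplex_exact L (K.complex.sc' (k + 2) (k + 1) k) h

theorem smul_id_single₀ {X : ModuleCat.{u} A} (c : A) (hc : c • 𝟙 X = 𝟙 X) :
    c • 𝟙 ((ChainComplex.single₀ (ModuleCat A)).obj X) = 𝟙 _ := by
  apply from_single_hom_ext
  rw [← cancel_epi (singleObjXSelf (ComplexShape.down ℕ) 0 X).inv,
    ← cancel_mono (singleObjXSelf (ComplexShape.down ℕ) 0 X).hom]
  simp only [Linear.comp_smul, Linear.smul_comp, Category.comp_id,
    HomologicalComplex.smul_f_apply, HomologicalComplex.id_f, Iso.inv_hom_id]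
  exact hc

/-- A scalar that acts as the identity on a module acts on its resolutions by a map that is
homotopic to the identity. -/
def smulHomotopy {X : ModuleCat.{u} A} (K : ProjectiveResolution X) (c : A)
    (hc : c • 𝟙 X = 𝟙 X) : Homotopy (𝟙 K.complex) (c • 𝟙 K.complex) :=
  ProjectiveResolution.liftHomotopy (𝟙 X) _ _ (by simp) (by
    have h : K.π ≫ (c • 𝟙 ((ChainComplex.single₀ (ModuleCat A)).obj X)) = K.π := by
      rw [smul_id_single₀ c hc, Category.comp_id]
    rw [Linear.comp_smul, Category.comp_id] at h
    rw [Linear.smul_comp, Category.id_comp, CategoryTheory.Functor.map_id, Category.comp_id, h])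

/-- A module through which multiplication by `c` factors over a flat module is acyclic for
`- ⊗ K`, if `K` resolves a module on which `c` acts as the identity. -/
theorem isZero_homology_tensorComplex {X : ModuleCat.{u} A} (K : ProjectiveResolution X)
    {P L : ModuleCat.{u} A} [Module.Flat A L] (φ : L ⟶ P) (ψ : P ⟶ L) (c : A)
    (hc : c • 𝟙 X = 𝟙 X) (hφψ : ψ ≫ φ = c • 𝟙 P) (k : ℕ) :
    IsZero (((tensorComplex K.complex).obj P).homology (k + 1)) := by
  have hL := isZero_homology_tensorComplex_of_flat K L k
  have h2 := (((tensoringLeft (ModuleCat.{u} A)).obj P).mapHomotopy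
    (smulHomotopy K c hc)).homologyMap_eq (k + 1)
  -- The scalar `c` moves across the tensor product from `K` to `P`, where it factors through `L`.
  have h3 : (((tensoringLeft (ModuleCat.{u} A)).obj P).mapHomologicalComplex _).map
      (c • 𝟙 K.complex) = (tensorComplex K.complex).map ψ ≫ (tensorComplex K.complex).map φ := by
    rw [← Functor.map_comp, hφψ]
    ext j : 1
    refine ModuleCat.MonoidalCategory.tensor_ext fun p x => ?_
    exact (TensorProduct.smul_tmul c p x).symm
  have h4 : homologyMap (𝟙 ((tensorComplex K.complex).obj P)) (k + 1) = homologyMap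
      ((tensorComplex K.complex).map ψ ≫ (tensorComplex K.complex).map φ) (k + 1) :=
    (congrArg (homologyMap · (k + 1)) (CategoryTheory.Functor.map_id _ _).symm).trans
      (h2.trans (congrArg (homologyMap · (k + 1)) h3))
  rw [homologyMap_comp, hL.eq_of_src (homologyMap ((tensorComplex K.complex).map φ) (k + 1)) 0,
    comp_zero, homologyMap_id] at h4
  exact (IsZero.iff_id_eq_zero _).2 h4

/-- The homology of `M ⊗ K` is computed by a resolution of `M` by acyclic modules whose
differentials induce zero on zeroth homology. -/
theorem nonempty_homology_iso_of_minimal (K : ChainComplex (ModuleCat.{u} A) ℕ)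
    [∀ k, Module.Flat A (K.X k)] (i : ℕ) (P : ℕ → ModuleCat.{u} A) (M : ModuleCat.{u} A)
    (d : ∀ i, P (i + 1) ⟶ P i) (ρ : P 0 ⟶ M) (hρ : Function.Surjective ρ)
    (hdρ : Function.Exact (d 0) ρ) (hd : ∀ i, Function.Exact (d (i + 1)) (d i))
    (hP : ∀ i k, IsZero (((tensorComplex K).obj (P i)).homology (k + 1)))
    (hmin : ∀ i, homologyMap ((tensorComplex K).map (d i)) 0 = 0) :
    Nonempty (((tensorComplex K).obj (P i)).homology 0 ≅
      ((tensorComplex K).obj M).homology i) := by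
  let N : ModuleCat.{u} A := ModuleCat.of A (LinearMap.ker ρ.hom)
  let ι : N ⟶ P 0 := ModuleCat.ofHom (Submodule.subtype _)
  let S : ShortComplex (ModuleCat.{u} A) := ShortComplex.mk ι ρ (by ext x; exact x.2)
  have hS : S.ShortExact :=
    ModuleCat.shortComplex_shortExact S (LinearMap.exact_subtype_ker_map ρ.hom)
      (Submodule.subtype_injective _) hρ
  have hT := tensorComplex_shortExact K S hS
  let ρ' : P 1 ⟶ N := ModuleCat.ofHom
    ((d 0).hom.codRestrict (LinearMap.ker ρ.hom) fun x => hdρ.apply_apply_eq_zero x)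
  have hρι : ρ' ≫ ι = d 0 := rfl
  have hρ' : Function.Surjective ρ' := fun x => by
    obtain ⟨y, hy⟩ := (hdρ x.1).1 x.2
    exact ⟨y, Subtype.ext hy⟩
  have hepi : Epi (homologyMap ((tensorComplex K).map ρ') 0) := by
    have : Epi ρ' := (ModuleCat.epi_iff_surjective _).2 hρ'
    exact epi_homologyMap_zero _ (inferInstanceAs (Epi ((tensorRight (K.X 0)).map ρ')))
  -- `P 1` surjects onto the kernel `N`, so its zeroth homology surjects too, and the composite to
  -- `P 0` is zero by minimality.
  have hι : homologyMap ((tensorComplex K).map ι) 0 = 0 := by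
    rw [← cancel_epi (homologyMap ((tensorComplex K).map ρ') 0), ← homologyMap_comp,
      ← Functor.map_comp, hρι, hmin, comp_zero]
  match i with
  | 0 => exact nonempty_homology_zero_iso hT hι
  | i + 1 =>
    have h0 : homologyMap ((tensorComplex K).map ι) i = 0 := by
      match i with
      | 0 => exact hι
      | i + 1 => exact (hP 0 i).eq_of_tgt _ _
    obtain ⟨e⟩ := nonempty_homology_succ_iso hT i (hP 0 i) h0
    have hdρ' : Function.Exact (d 1) ρ' := fun x => by
      rw [← hd 0 x]
      exact Subtype.ext_iff
    -- The shifted resolution of `N` satisfies the same hypotheses, and the connecting map lowers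
    -- the degree by one.
    obtain ⟨e'⟩ := nonempty_homology_iso_of_minimal K i (fun j => P (j + 1)) N
      (fun j => d (j + 1)) ρ' hρ' hdρ' (fun j => hd (j + 1)) (fun j => hP (j + 1))
      (fun j => hmin (j + 1))
    exact ⟨e' ≪≫ e.symm⟩

end TensorComplex

/-! ### Sections of vector bundles near a point -/

section LocalFrames

variable {V : Type u} [NormedAddCommGroup V] [NormedSpace ℝ V]
  {Fib : Type*} [NormedAddCommGroup Fib] [NormedSpace ℝ Fib]
  {E : V → Type*} [TopologicalSpace (TotalSpace Fib E)]
  [∀ x, TopologicalSpace (E x)] [∀ x, AddCommGroup (E x)] [∀ x, Module ℝ (E x)]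
  [FiberBundle Fib E] [VectorBundle ℝ Fib E]

theorem smul_section_apply (f : SmoothFun V) (s : Cₛ^∞⟮𝓘(ℝ, V); Fib, E⟯) (x : V) :
    (f • s) x = f x • s x := rfl

theorem sum_section_apply {ι : Type*} (t : Finset ι) (s : ι → Cₛ^∞⟮𝓘(ℝ, V); Fib, E⟯) (x : V) :
    (∑ i ∈ t, s i) x = ∑ i ∈ t, s i x := by
  classical
  induction t using Finset.induction_on with
  | empty => rfl
  | insert a t ha ih => rw [Finset.sum_insert ha, Finset.sum_insert ha, ← ih]; rfl

/-- Evaluation of sections at a point. -/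
def evalSection (p : V) : Cₛ^∞⟮𝓘(ℝ, V); Fib, E⟯ →ₗ[SmoothFun V] AtPoint p (E p) where
  toFun s := s p
  map_add' _ _ := rfl
  map_smul' _ _ := rfl

variable [FiniteDimensional ℝ V] [FiniteDimensional ℝ Fib] [ContMDiffVectorBundle ∞ Fib E 𝓘(ℝ, V)]

variable (E) in
/-- Near a point `p`, the sections of a vector bundle look like tuples of smooth functions. -/
theorem exists_cutoff_frame (p : V) :
    ∃ (r : ℕ) (φ : (Fin r → SmoothFun V) →ₗ[SmoothFun V] Cₛ^∞⟮𝓘(ℝ, V); Fib, E⟯)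
      (ψ : Cₛ^∞⟮𝓘(ℝ, V); Fib, E⟯ →ₗ[SmoothFun V] (Fin r → SmoothFun V)) (c : SmoothFun V),
      c p = 1 ∧ (∀ s, φ (ψ s) = c • s) ∧ (∀ s, s p = 0 → ∀ i, ψ s i p = 0) ∧
      ∀ v : E p, ∃ s : Cₛ^∞⟮𝓘(ℝ, V); Fib, E⟯, s p = v := by
  have h1 : ContMDiffVectorBundle 1 Fib E 𝓘(ℝ, V) := ContMDiffVectorBundle.of_le (n := ∞) (by simp)
  let e := trivializationAt Fib E p
  let b := Module.finBasis ℝ Fib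
  have hp : p ∈ e.baseSet := mem_baseSet_trivializationAt Fib E p
  obtain ⟨χ, hχ, -, hχs, -, hχp⟩ := exists_contDiff_tsupport_subset (n := ⊤)
    (e.open_baseSet.mem_nhds hp)
  have hχm : ContMDiff 𝓘(ℝ, V) 𝓘(ℝ, ℝ) ∞ χ := hχs.contMDiff
  let S : Fin (Module.finrank ℝ Fib) → Cₛ^∞⟮𝓘(ℝ, V); Fib, E⟯ := fun i =>
    ⟨fun x => χ x • e.localFrame b i x,
      ContMDiffOn.smul_section_of_tsupport hχm.contMDiffOn e.open_baseSet hχ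
        (e.contMDiffOn_localFrame_baseSet ∞ b i)⟩
  have hcoeff : ∀ (s : Cₛ^∞⟮𝓘(ℝ, V); Fib, E⟯) i, ContMDiff 𝓘(ℝ, V) 𝓘(ℝ, ℝ) ∞
      (fun x => χ x • e.localFrameCoeff 𝓘(ℝ, V) b i x (s x)) := by
    intro s i
    refine contMDiff_of_tsupport fun x hx => ?_
    have hx' : x ∈ e.baseSet := hχ (closure_mono (Function.support_smul_subset_left _ _) hx)
    exact (hχm x).smul (contMDiffAt_localFrameCoeff b hx' (s.contMDiff x) i)
  let ψ : Cₛ^∞⟮𝓘(ℝ, V); Fib, E⟯ →ₗ[SmoothFun V] (Fin _ → SmoothFun V) :=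
    { toFun := fun s i => ⟨_, hcoeff s i⟩
      map_add' := fun s t => by
        ext i x
        exact (congrArg (χ x • ·) (map_add (e.localFrameCoeff 𝓘(ℝ, V) b i x) (s x) (t x))).trans
          (smul_add _ _ _)
      map_smul' := fun f s => by
        ext i x
        exact (congrArg (χ x • ·) (map_smul (e.localFrameCoeff 𝓘(ℝ, V) b i x) (f x) (s x))).trans
          (smul_comm _ _ _) }
  let φ : (Fin (Module.finrank ℝ Fib) → SmoothFun V) →ₗ[SmoothFun V] Cₛ^∞⟮𝓘(ℝ, V); Fib, E⟯ :=
    Fintype.linearCombination (SmoothFun V) S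
  have hφ : ∀ f x, φ f x = ∑ i, f i x • χ x • e.localFrame b i x := by
    intro f x
    simp only [φ, Fintype.linearCombination_apply]
    rw [sum_section_apply]
    rfl
  -- One factor `χ` extends the frame by zero, the other extends the coefficients.
  let c : SmoothFun V := ⟨χ, hχm⟩ * ⟨χ, hχm⟩
  have hφψ : ∀ s, φ (ψ s) = c • s := by
    intro s
    ext x
    rw [hφ, smul_section_apply]
    change ∑ i, (χ x • e.localFrameCoeff 𝓘(ℝ, V) b i x (s x)) • χ x • e.localFrame b i x =
      (χ x * χ x) • s x
    by_cases hx : x ∈ e.baseSet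
    · conv_rhs => rw [e.eq_sum_localFrameCoeff_smul (I := 𝓘(ℝ, V)) (b := b) (s := s) hx]
      rw [Finset.smul_sum]
      refine Finset.sum_congr rfl fun i _ => ?_
      simp only [smul_smul, smul_eq_mul]
      ring_nf
    · have : χ x = 0 := by
        by_contra h
        exact hx (hχ (subset_tsupport _ h))
      simp [this]
  refine ⟨_, φ, ψ, c, by change χ p * χ p = 1; rw [hχp, mul_one], hφψ, ?_, ?_⟩
  · intro s hs i
    change χ p • e.localFrameCoeff 𝓘(ℝ, V) b i p (s p) = 0
    rw [hs, map_zero, smul_zero]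
  · intro v
    refine ⟨φ fun i => ContMDiffMap.const ((e.basisAt b hp).repr v i), ?_⟩
    rw [hφ]
    conv_rhs => rw [← (e.basisAt b hp).sum_repr v]
    refine Finset.sum_congr rfl fun i _ => ?_
    rw [hχp, one_smul, e.localFrame_apply_of_mem_baseSet b hp]
    rfl

end LocalFrames

/-! ### Smooth maps to a vector space -/

section Trivial

variable {V : Type u} [NormedAddCommGroup V] [NormedSpace ℝ V]

theorem trivSec_free (W : Type u) [NormedAddCommGroup W] [NormedSpace ℝ W]
    [FiniteDimensional ℝ W] : Module.Free (SmoothFun V) (TrivSec V W) := by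
  let b := Module.finBasis ℝ W
  let e : TrivSec V W ≃ₗ[SmoothFun V] (Fin (Module.finrank ℝ W) → SmoothFun V) :=
    { toFun := fun f i => ⟨fun x => b.coord i (f x),
        ((b.coord i).toContinuousLinearMap.contDiff.comp f.contMDiff.contDiff).contMDiff⟩
      invFun := fun g => ⟨fun x => ∑ i, g i x • b i,
        (ContDiff.sum fun i _ => ((g i).contMDiff.contDiff.smul contDiff_const)).contMDiff⟩
      map_add' := fun f g => by
        ext i x
        exact map_add (b.coord i) (f x) (g x)
      map_smul' := fun f g => by
        ext i x
        exact map_smul (b.coord i) (f x) (g x)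
      left_inv := fun f => by
        ext x
        exact b.sum_repr (f x)
      right_inv := fun g => by
        ext i x
        change b.repr (∑ i, g i x • b i) i = g i x
        rw [b.repr_sum_self] }
  exact Module.Free.of_equiv e.symm

end Trivial

/-! ### The Koszul resolution of the residue field at the origin -/

section KoszulResolution

open MonoidalCategory Limits HomologicalComplex

/-- An exact augmented complex of projective modules is a projective resolution. -/
def projectiveResolutionOfExact {A : Type u} [CommRing A] (C : ChainComplex (ModuleCat.{u} A) ℕ)
    [∀ k, Projective (C.X k)] {X : ModuleCat.{u} A} (ε : C.X 0 ⟶ X)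
    (hε : Function.Surjective ε) (h0 : Function.Exact (C.d 1 0) ε)
    (h : ∀ k, Function.Exact (C.d (k + 2) (k + 1)) (C.d (k + 1) k)) :
    ProjectiveResolution X :=
  ⟨C, inferInstance, (ChainComplex.toSingle₀Equiv _ _).symm
    ⟨ε, by ext x; exact h0.apply_apply_eq_zero x⟩, ⟨fun n => by
    -- In degree 0 a quasi-isomorphism to `X` means that `C₁ → C₀ → X → 0` is exact; in positive
    -- degrees the target vanishes and exactness of `C` remains.
    cases n with
    | zero =>
      rw [ChainComplex.quasiIsoAt₀_iff, ShortComplex.quasiIso_iff_of_zeros']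
      · have w : C.d 1 0 ≫ ε = 0 := by ext x; exact h0.apply_apply_eq_zero x
        have e : (ShortComplex.mk _ _ w).Exact :=
          (ShortComplex.ShortExact.moduleCat_exact_iff_function_exact _).2 h0
        have e' : Epi ε := (ModuleCat.epi_iff_surjective _).2 hε
        refine (ShortComplex.exact_and_epi_g_iff_of_iso ?_).2 ⟨e, e'⟩
        exact ShortComplex.isoMk (Iso.refl _) (Iso.refl _) (Iso.refl _)
          ((Category.id_comp _).trans (Category.comp_id _).symm)
          ((Category.id_comp _).trans (Category.comp_id _).symm)
      · exact C.shape _ _ (by simp)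
      all_goals rfl
    | succ k =>
      rw [quasiIsoAt_iff_exactAt']
      · rw [exactAt_iff' _ (k + 2) (k + 1) k (by simp) (by simp)]
        exact (ShortComplex.ShortExact.moduleCat_exact_iff_function_exact _).2 (h k)
      · apply ChainComplex.exactAt_succ_single_obj⟩⟩

variable (V : Type u) [NormedAddCommGroup V] [NormedSpace ℝ V]

/-- The Koszul complex of the Euler vector field. -/
def eulerComplex : ChainComplex (ModuleCat.{u} (SmoothFun V)) ℕ :=
  ChainComplex.of (fun k => ModuleCat.of (SmoothFun V) (Forms V k))
    (fun k => ModuleCat.ofHom (contractEuler V k))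
    (fun k => by rw [← ModuleCat.ofHom_comp, contractEuler_comp]; rfl)

theorem eulerComplex_d (k : ℕ) :
    (eulerComplex V).d (k + 1) k = ModuleCat.ofHom (contractEuler V k) :=
  ChainComplex.of_d (fun k => ModuleCat.of (SmoothFun V) (Forms V k))
    (fun k => ModuleCat.ofHom (contractEuler V k)) k

/-- A `0`-form, seen as a function. -/
def zeroFormToFun : Forms V 0 →ₗ[SmoothFun V] SmoothFun V where
  toFun α := ⟨fun x => α x ![], ((ContinuousAlternatingMap.apply ℝ V ℝ ![]).contDiff.comp
    α.contMDiff.contDiff).contMDiff⟩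
  map_add' _ _ := rfl
  map_smul' _ _ := rfl

/-- The `0`-form `1`. -/
def oneForm₀ : Forms V 0 :=
  ContMDiffMap.const (ContinuousAlternatingMap.constOfIsEmpty ℝ V (Fin 0) (1 : ℝ))

variable {V}

theorem zeroFormToFun_smul_one (α : Forms V 0) : zeroFormToFun V α • oneForm₀ V = α := by
  ext x v
  change α x ![] * 1 = α x v
  rw [mul_one, Subsingleton.elim ![] v]

theorem zeroFormToFun_oneForm₀ : zeroFormToFun V (oneForm₀ V) = 1 := rfl

theorem zeroFormToFun_contractEuler (β : Forms V 1) :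
    zeroFormToFun V (contractEuler V 0 β) 0 = 0 := by
  change (β 0).curryLeft 0 ![] = 0
  rw [map_zero]
  rfl

theorem smul_atPoint_eq_zero {W : Type*} [AddCommGroup W] [Module ℝ W] {p : V} {f : SmoothFun V}
    (hf : f p = 0) (w : AtPoint p W) : f • w = 0 := by
  let w' : W := w
  change f p • w' = (0 : W)
  rw [hf, zero_smul]

variable (V) in
/-- The augmentation of the Koszul complex of the Euler vector field. -/
def eulerAugmentation : Forms V 0 →ₗ[SmoothFun V] ULift.{u} (AtPoint (0 : V) ℝ) where
  toFun α := ULift.up (zeroFormToFun V α 0)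
  map_add' _ _ := rfl
  map_smul' _ _ := rfl

variable [FiniteDimensional ℝ V]

instance finiteDimensional_continuousAlternatingMap (k : ℕ) :
    FiniteDimensional ℝ (V [⋀^Fin k]→L[ℝ] ℝ) :=
  Module.Finite.of_injective
    ((ContinuousMultilinearMap.toMultilinearMapLinear (R' := ℝ) (A := ℝ) (M₁ := fun _ : Fin k => V)
      (M₂ := ℝ)).comp
      (ContinuousAlternatingMap.toContinuousMultilinearMapLinear (R := ℝ) (A := ℝ) (M := V)
        (N := ℝ) (ι := Fin k)))
    (ContinuousMultilinearMap.toMultilinearMap_injective.comp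
      ContinuousAlternatingMap.toContinuousMultilinearMap_injective)

instance (k : ℕ) : Module.Free (SmoothFun V) ((eulerComplex V).X k) :=
  trivSec_free (V [⋀^Fin k]→L[ℝ] ℝ)

variable (V) in
/-- The Koszul complex of the Euler vector field resolves `ℝ`, regarded as a module through
evaluation at the origin. -/
def eulerResolution :
    ProjectiveResolution (ModuleCat.of (SmoothFun V) (ULift.{u} (AtPoint (0 : V) ℝ))) :=
  haveI (k : ℕ) : Projective ((eulerComplex V).X k) :=
    ModuleCat.projective_of_categoryTheory_projective _
  projectiveResolutionOfExact (eulerComplex V) (ModuleCat.ofHom (eulerAugmentation V))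
    (fun r => ⟨(ContMDiffMap.const (show ℝ from r.down) : SmoothFun V) • oneForm₀ V,
      congrArg ULift.up (mul_one (show ℝ from r.down))⟩)
    (by
      rw [eulerComplex_d]
      intro α
      constructor
      · intro h
        refine exists_contractEuler_zero_eq α ?_
        ext v
        rw [Subsingleton.elim v ![]]
        exact congrArg ULift.down h
      · rintro ⟨β, rfl⟩
        exact congrArg ULift.up (zeroFormToFun_contractEuler β))
    (fun k => by
      rw [eulerComplex_d, eulerComplex_d]
      intro α
      constructor
      · exact exists_contractEuler_eq α
      · rintro ⟨β, rfl⟩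
        exact LinearMap.congr_fun (contractEuler_comp V k) β)

/-- The Koszul complex with coefficients in `M` computes `Tor`. -/
theorem nonempty_torAt_iso (i : ℕ) (M : Type u) [AddCommGroup M] [Module (SmoothFun V) M] :
    Nonempty (torAt V 0 i M ≅
      ((tensorComplex (eulerComplex V)).obj (ModuleCat.of _ M)).homology i) :=
  -- `Tor` is derived in its second variable, so resolving `ℝ` suffices and no balancing is needed.
  ⟨(eulerResolution V).isoLeftDerivedObj
    ((tensoringLeft (ModuleCat.{u} (SmoothFun V))).obj (ModuleCat.of _ M)) i⟩

omit [FiniteDimensional ℝ V] in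
theorem nonempty_koszul_iso (M : Type u) [AddCommGroup M] [Module (SmoothFun V) M] :
    Nonempty (koszul V M ≅ (tensorComplex (eulerComplex V)).obj (ModuleCat.of _ M)) := by
  refine ⟨Hom.isoOfComponents
    (fun k => (TensorProduct.comm (SmoothFun V) (Forms V k) M).toModuleIso) ?_⟩
  rintro i j rfl
  have h1 : (koszul V M).d (j + 1) j = ModuleCat.ofHom ((contractEuler V j).rTensor M) :=
    ChainComplex.of_d (fun k => ModuleCat.of (SmoothFun V) (Forms V k ⊗[SmoothFun V] M))
      (fun k => ModuleCat.ofHom ((contractEuler V k).rTensor M)) j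
  have h2 : ((tensorComplex (eulerComplex V)).obj (ModuleCat.of _ M)).d (j + 1) j =
      ModuleCat.ofHom ((contractEuler V j).lTensor M) := by
    change ModuleCat.of _ M ◁ (eulerComplex V).d (j + 1) j = _
    rw [eulerComplex_d]
    rfl
  rw [h1, h2]
  ext : 1
  exact TensorProduct.ext' fun α m => rfl

end KoszulResolution

/-! ### Zeroth homology and minimality -/

section Minimal

open MonoidalCategory Limits HomologicalComplex

variable {V : Type u} [NormedAddCommGroup V] [NormedSpace ℝ V]

theorem eulerComplex_tensor_d (P : ModuleCat.{u} (SmoothFun V)) (j : ℕ) :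
    ((tensorComplex (eulerComplex V)).obj P).d (j + 1) j =
      ModuleCat.ofHom ((contractEuler V j).lTensor P) := by
  change P ◁ (eulerComplex V).d (j + 1) j = _
  rw [eulerComplex_d]
  rfl

section Augmentation

variable {P : Type u} [AddCommGroup P] [Module (SmoothFun V) P]

/-- The 0-forms are free of rank one on the constant form 1, so all coefficients move to the left
factor. -/
theorem exists_eq_tmul_oneForm₀ (z : P ⊗[SmoothFun V] Forms V 0) :
    ∃ s : P, z = s ⊗ₜ oneForm₀ V := by
  induction z with
  | zero => exact ⟨0, (TensorProduct.zero_tmul _ _).symm⟩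
  | tmul s α =>
    refine ⟨zeroFormToFun V α • s, ?_⟩
    rw [TensorProduct.smul_tmul, zeroFormToFun_smul_one]
  | add z w hz hw =>
    obtain ⟨s, rfl⟩ := hz
    obtain ⟨t, rfl⟩ := hw
    exact ⟨s + t, (TensorProduct.add_tmul _ _ _).symm⟩

variable {Q : Type*} [AddCommGroup Q] [Module (SmoothFun V) Q]

/-- The augmentation of `P ⊗ Γ(∧^• V*)` induced by a linear map `P → Q`. -/
def tensorAugmentation (ev : P →ₗ[SmoothFun V] Q) : P ⊗[SmoothFun V] Forms V 0 →ₗ[SmoothFun V] Q :=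
  TensorProduct.lift
    ((LinearMap.lsmul (SmoothFun V) Q).compl₁₂ (zeroFormToFun V) ev).flip

theorem tensorAugmentation_tmul (ev : P →ₗ[SmoothFun V] Q) (s : P) (α : Forms V 0) :
    tensorAugmentation ev (s ⊗ₜ α) = zeroFormToFun V α • ev s := rfl

theorem tensorAugmentation_tmul_one (ev : P →ₗ[SmoothFun V] Q) (s : P) :
    tensorAugmentation ev (s ⊗ₜ oneForm₀ V) = ev s := by
  rw [tensorAugmentation_tmul, zeroFormToFun_oneForm₀, one_smul]

variable [FiniteDimensional ℝ V]

/-- Under `P ⊗ K₀ = P`, Hadamard's lemma identifies the boundaries with `mP`; `hQ` places `mP`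
inside the kernel of `ev`, and `hker` gives the converse. -/
theorem exact_tensorAugmentation (ev : P →ₗ[SmoothFun V] Q)
    (hQ : ∀ (f : SmoothFun V) (q : Q), f 0 = 0 → f • q = 0)
    (hker : LinearMap.ker ev ≤ RingHom.ker (evalAt (0 : V)) • (⊤ : Submodule (SmoothFun V) P)) :
    Function.Exact ((contractEuler V 0).lTensor P) (tensorAugmentation ev) := by
  intro z
  constructor
  · intro hz
    obtain ⟨s, rfl⟩ := exists_eq_tmul_oneForm₀ z
    rw [tensorAugmentation_tmul_one] at hz
    change s ⊗ₜ oneForm₀ V ∈ LinearMap.range ((contractEuler V 0).lTensor P)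
    refine Submodule.smul_induction_on (p := fun s => s ⊗ₜ oneForm₀ V ∈
      LinearMap.range ((contractEuler V 0).lTensor P)) (hker hz) ?_ ?_
    · intro f hf t _
      have h0 : (f • oneForm₀ V) 0 = 0 := by
        change f 0 • (oneForm₀ V) 0 = 0
        rw [show f 0 = 0 from hf, zero_smul]
      obtain ⟨β, hβ⟩ := exists_contractEuler_zero_eq (f • oneForm₀ V) h0
      exact ⟨t ⊗ₜ β, by rw [LinearMap.lTensor_tmul, hβ, TensorProduct.smul_tmul]⟩
    · intro s t hs ht
      rw [TensorProduct.add_tmul]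
      exact Submodule.add_mem _ hs ht
  · rintro ⟨w, rfl⟩
    induction w with
    | zero => simp
    | tmul s β =>
      rw [LinearMap.lTensor_tmul, tensorAugmentation_tmul]
      exact hQ _ _ (zeroFormToFun_contractEuler β)
    | add z w hz hw => rw [map_add, map_add, hz, hw, add_zero]

theorem nonempty_homology_zero_equiv (ev : P →ₗ[SmoothFun V] Q)
    (hev : Function.Surjective ev)
    (hQ : ∀ (f : SmoothFun V) (q : Q), f 0 = 0 → f • q = 0)
    (hker : LinearMap.ker ev ≤ RingHom.ker (evalAt (0 : V)) • (⊤ : Submodule (SmoothFun V) P)) :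
    Nonempty (((tensorComplex (eulerComplex V)).obj (ModuleCat.of _ P)).homology 0
      ≃ₗ[SmoothFun V] Q) := by
  refine exists_homology_zero_equiv _ (tensorAugmentation ev) ?_ ?_
  · intro q
    obtain ⟨s, rfl⟩ := hev q
    exact ⟨s ⊗ₜ oneForm₀ V, tensorAugmentation_tmul_one ev s⟩
  · rw [eulerComplex_tensor_d]
    exact exact_tensorAugmentation ev hQ hker

theorem homologyMap_zero_eq_zero_of_evaluation {P' : Type u} [AddCommGroup P']
    [Module (SmoothFun V) P'] (f : P' →ₗ[SmoothFun V] P) (ev : P →ₗ[SmoothFun V] Q)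
    (hf : ∀ s, ev (f s) = 0)
    (hQ : ∀ (f : SmoothFun V) (q : Q), f 0 = 0 → f • q = 0)
    (hker : LinearMap.ker ev ≤ RingHom.ker (evalAt (0 : V)) • (⊤ : Submodule (SmoothFun V) P)) :
    homologyMap ((tensorComplex (eulerComplex V)).map (ModuleCat.ofHom f)) 0 = 0 := by
  refine homologyMap_zero_eq_zero _ fun z => ?_
  obtain ⟨s, rfl⟩ := exists_eq_tmul_oneForm₀ (P := P') z
  rw [eulerComplex_tensor_d]
  refine (exact_tensorAugmentation ev hQ hker (f s ⊗ₜ oneForm₀ V)).1 ?_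
  rw [tensorAugmentation_tmul_one, hf]

end Augmentation

variable [FiniteDimensional ℝ V]

/-- A module with a minimal resolution by modules that look like free modules near the origin. -/
theorem nonempty_homology_equiv_of_minimal (P : ℕ → Type u) [∀ i, AddCommGroup (P i)]
    [∀ i, Module (SmoothFun V) (P i)] (Q : ℕ → Type*) [∀ i, AddCommGroup (Q i)]
    [∀ i, Module (SmoothFun V) (Q i)] (M : Type u) [AddCommGroup M] [Module (SmoothFun V) M]
    (d : ∀ i, P (i + 1) →ₗ[SmoothFun V] P i) (ρ : P 0 →ₗ[SmoothFun V] M)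
    (hρ : Function.Surjective ρ) (hdρ : Function.Exact (d 0) ρ)
    (hd : ∀ i, Function.Exact (d (i + 1)) (d i))
    (ev : ∀ i, P i →ₗ[SmoothFun V] Q i) (hev : ∀ i, Function.Surjective (ev i))
    (hQ : ∀ i (f : SmoothFun V) (q : Q i), f 0 = 0 → f • q = 0)
    (hmin : ∀ i s, ev i (d i s) = 0)
    (hloc : ∀ i, ∃ (r : ℕ) (φ : (Fin r → SmoothFun V) →ₗ[SmoothFun V] P i)
      (ψ : P i →ₗ[SmoothFun V] (Fin r → SmoothFun V)) (c : SmoothFun V),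
      c 0 = 1 ∧ (∀ s, φ (ψ s) = c • s) ∧ (∀ s, ev i s = 0 → ∀ j, ψ s j 0 = 0)) (i : ℕ) :
    Nonempty (Q i ≃ₗ[SmoothFun V]
      ((tensorComplex (eulerComplex V)).obj (ModuleCat.of _ M)).homology i) := by
  have hker : ∀ i, LinearMap.ker (ev i) ≤
      RingHom.ker (evalAt (0 : V)) • (⊤ : Submodule (SmoothFun V) (P i)) := by
    intro i s hs
    obtain ⟨r, φ, ψ, c, hc, hφψ, h0⟩ := hloc i
    -- The sum is `φ (ψ s) = c • s`. All the coefficients `1 - c` and `ψ s j` vanish at 0.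
    have e : s = (1 - c) • s + ∑ j, ψ s j • φ (Pi.single j 1) := by
      have e1 : ∑ j, ψ s j • φ (Pi.single j 1) = φ (ψ s) := by
        simp only [← map_smul, ← map_sum]
        congr 1
        exact pi_eq_sum_univ' (ψ s) |>.symm
      rw [e1, hφψ, ← add_smul, sub_add_cancel, one_smul]
    rw [e]
    refine Submodule.add_mem _ (Submodule.smul_mem_smul ?_ trivial)
      (Submodule.sum_mem _ fun j _ => Submodule.smul_mem_smul (h0 s hs j) trivial)
    change 1 - c 0 = 0
    rw [hc, sub_self]
  have hacyc : ∀ i k, IsZero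
      (((tensorComplex (eulerComplex V)).obj (ModuleCat.of _ (P i))).homology (k + 1)) := by
    intro i k
    obtain ⟨r, φ, ψ, c, hc, hφψ, -⟩ := hloc i
    refine isZero_homology_tensorComplex (eulerResolution V) (P := ModuleCat.of _ (P i))
      (L := ModuleCat.of _ (ULift.{u} (Fin r) → SmoothFun V))
      (ModuleCat.ofHom (φ ∘ₗ (LinearMap.funLeft _ _ ULift.up)))
      (ModuleCat.ofHom ((LinearMap.funLeft _ _ ULift.down) ∘ₗ ψ)) c ?_ ?_ k
    · ext q
      change c 0 * (show ℝ from q.down) = (show ℝ from q.down)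
      rw [hc, one_mul]
    · ext s
      exact hφψ s
  obtain ⟨e⟩ := nonempty_homology_iso_of_minimal (eulerComplex V) i
    (fun i => ModuleCat.of _ (P i)) (ModuleCat.of _ M) (fun i => ModuleCat.ofHom (d i))
    (ModuleCat.ofHom ρ) hρ hdρ hd hacyc
    (fun i => homologyMap_zero_eq_zero_of_evaluation (d i) (ev i) (hmin i) (hQ i) (hker i))
  obtain ⟨e'⟩ := nonempty_homology_zero_equiv (ev i) (hev i) (hQ i) (hker i)
  exact ⟨e'.symm ≪≫ₗ e.toLinearEquiv⟩

end Minimal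

/-! ### Universe level of section modules -/

section Size

variable {V : Type u} [NormedAddCommGroup V] [NormedSpace ℝ V]
  {Fib : Type*} [NormedAddCommGroup Fib] [NormedSpace ℝ Fib] [FiniteDimensional ℝ Fib]
  {E : V → Type*} [TopologicalSpace (TotalSpace Fib E)]
  [∀ x, TopologicalSpace (E x)] [∀ x, AddCommGroup (E x)] [∀ x, Module ℝ (E x)]
  [FiberBundle Fib E] [VectorBundle ℝ Fib E]

/-- A section is determined by its coordinates at each `x` in the trivialization chosen at `x`, a
function on `V` with values in a fixed `ℝ^r`. This allows section modules from other universes into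
`ModuleCat.{u}`. -/
instance small_section : Small.{u} Cₛ^∞⟮𝓘(ℝ, V); Fib, E⟯ := by
  let b := Module.finBasis ℝ Fib
  refine small_of_injective (β := V → Fin (Module.finrank ℝ Fib) → ℝ)
    (f := fun s x => b.equivFun ((trivializationAt Fib E x).linearEquivAt ℝ x
      (FiberBundle.mem_baseSet_trivializationAt' x) (s x))) fun s t h => ?_
  ext x
  exact ((trivializationAt Fib E x).linearEquivAt ℝ x _).injective
    (b.equivFun.injective (congrFun h x))

end Size

end SingFol

end

theorem mainTheorem6 {V : Type*} [NormedAddCommGroup V] [NormedSpace ℝ V] [FiniteDimensional ℝ V]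
    (F : SingFol.SingularFoliation V) (hF : F.IsLeaf {0})
    {Fib : ℕ → Type*} [∀ i, NormedAddCommGroup (Fib i)] [∀ i, NormedSpace ℝ (Fib i)]
    [∀ i, FiniteDimensional ℝ (Fib i)]
    (E : ℕ → V → Type*) [∀ i, TopologicalSpace (TotalSpace (Fib i) (E i))]
    [∀ i x, TopologicalSpace (E i x)] [∀ i x, AddCommGroup (E i x)]
    [∀ i x, Module ℝ (E i x)] [∀ i, FiberBundle (Fib i) (E i)]
    [∀ i, VectorBundle ℝ (Fib i) (E i)]
    [∀ i, ContMDiffVectorBundle ∞ (Fib i) (E i) 𝓘(ℝ, V)]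
    (R : SingFol.Resolution F (Fib := Fib) E) (hR : R.IsMinimalAt 0) (i : ℕ) :
    Nonempty (SingFol.AtPoint (0 : V) (E i 0) ≃ₗ[SingFol.SmoothFun V]
      (SingFol.koszul V F.globalSections).homology i) ∧
    Nonempty (SingFol.AtPoint (0 : V) (E i 0) ≃ₗ[SingFol.SmoothFun V]
      SingFol.torAt V 0 i F.globalSections) := by
  -- The resolution is transported to copies of the section modules in the universe of `V`;
  -- exactness, minimality and cutoff frames carry over along these equivalences.
  let sh := fun i => Shrink.linearEquiv (SingFol.SmoothFun V) Cₛ^∞⟮𝓘(ℝ, V); Fib i, E i⟯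
  obtain ⟨e⟩ := SingFol.nonempty_homology_equiv_of_minimal
    (fun i => Shrink Cₛ^∞⟮𝓘(ℝ, V); Fib i, E i⟯) (fun i => SingFol.AtPoint (0 : V) (E i 0))
    F.globalSections (fun i => (sh i).symm.toLinearMap ∘ₗ R.d i ∘ₗ (sh (i + 1)).toLinearMap)
    (R.ρ ∘ₗ (sh 0).toLinearMap) (R.surjective_ρ.comp (sh 0).surjective)
    (by
      intro x
      simp only [LinearMap.comp_apply, LinearEquiv.coe_coe]
      rw [R.exact_ρ]
      constructor
      · rintro ⟨y, hy⟩
        exact ⟨(sh 1).symm y, by simp [hy]⟩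
      · rintro ⟨y, rfl⟩
        exact ⟨sh 1 y, by simp⟩)
    (by
      intro j x
      simp only [LinearMap.comp_apply, LinearEquiv.coe_coe, LinearEquiv.map_eq_zero_iff]
      rw [R.exact_d]
      constructor
      · rintro ⟨y, hy⟩
        exact ⟨(sh (j + 2)).symm y, by simp [hy]⟩
      · rintro ⟨y, rfl⟩
        exact ⟨sh (j + 2) y, by simp⟩)
    (fun i => SingFol.evalSection 0 ∘ₗ (sh i).toLinearMap)
    (fun j v => by
      obtain ⟨r, φ, ψ, c, -, -, -, h⟩ := SingFol.exists_cutoff_frame (Fib := Fib j) (E j) (0 : V)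
      obtain ⟨s, hs⟩ := h v
      exact ⟨(sh j).symm s,
        (congrArg (SingFol.evalSection 0) ((sh j).apply_symm_apply s)).trans hs⟩)
    (fun j f q hf => SingFol.smul_atPoint_eq_zero hf q)
    (fun j s => by
      simp only [LinearMap.comp_apply, LinearEquiv.coe_coe, LinearEquiv.apply_symm_apply]
      exact hR j _)
    (fun j => by
      obtain ⟨r, φ, ψ, c, hc, hφψ, h0, -⟩ :=
        SingFol.exists_cutoff_frame (Fib := Fib j) (E j) (0 : V)
      exact ⟨r, (sh j).symm.toLinearMap ∘ₗ φ, ψ ∘ₗ (sh j).toLinearMap, c, hc,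
        fun s => by simp [hφψ], fun s hs => h0 _ hs⟩) i
  obtain ⟨k⟩ := SingFol.nonempty_koszul_iso (V := V) F.globalSections
  obtain ⟨t⟩ := SingFol.nonempty_torAt_iso (V := V) i F.globalSections
  exact ⟨⟨e ≪≫ₗ (HomologicalComplex.homologyMapIso k i).symm.toLinearEquiv⟩,
    ⟨e ≪≫ₗ t.symm.toLinearEquiv⟩⟩
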